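/- Let $B_n=\{0,1\}^n$, and for $X=(x_1,\dots,x_n)\in B_n$ let $a_X=\frac1n\sum_{i=1}^n x_i$. A quantum algorithm with $T$ queries works on finitely many qubits (address register, one answer qubit, work register). It prepares the state $$\psi_X=U_TQ_XU_{T-1}Q_X\cdots U_1Q_XU_0\,\psi_0 ,$$ where the unit vector $\psi_0$ and the unitaries $U_0,\dots,U_T$ do not depend on $X$, and $Q_X$ is the query $|i\rangle|b\rangle|z\rangle\mapsto|i\rangle|b\oplus x_i\rangle|z\rangle$ (addresses $i$ that name no variable leave the state unchanged). It then performs a measurement, independent of $X$, with finitely many outcomes $j\in\{0,\dots,M-1\}$; outcome $j$ has probability $p_X(j)$, and the algorithm then returns a real number $\hat a(j)$ determined by the outcome $j$. For $\frac12<p\le1$ its error on input $X$ is $$e(X,T,p)=\inf\Big\{\gamma:\ \sum_{j:\,|a_X-\hat a(j)|\le\gamma}p_X(j)\ge p\Big\},$$ and its average probabilistic error for the uniform measure $\mu_1(X)=2^{-n}$ is $e^{\mathrm{avg}}(B_n,T,p)=\sum_{X\in B_n}e(X,T,p)\,\mu_1(X)$. **Lemma 3.1.** There are absolute constants $c>0$,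 $C>0$ and $N\in\mathbb N$ such that for every $n\ge N$, every $p\in(\frac12,1]$, every $T\ge 0$ and every quantum algorithm with $T$ queries, $$e^{\mathrm{avg}}(B_n,T,p)\le c\,n^{-1/2}\quad\Longrightarrow\quad T\ge C\,n^{1/2}.$$ -/

import Mathlib

open Matrix

namespace BoolMean

/-- The mean `a_X = |X| / n` of `n` Boolean variables. -/
noncomputable def mean {n : ℕ} (X : Fin n → Bool) : ℝ :=
  (∑ i, if X i then (1 : ℝ) else 0) / n

/-- Labels `(i, b, z)` of the computational basis states `|i⟩|b⟩|z⟩` of `a + 1 + w` qubits: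
an address register of `a` qubits, one answer qubit, and a work register of `w` qubits.
A vector of `(ℂ²)^⊗(a + 1 + w)` is given by its amplitudes, a function on these labels. -/
abbrev Label (a w : ℕ) : Type := Fin (2 ^ a) × Bool × Fin (2 ^ w)

/-- The answer of the black box for `X` on input `i`; an address `i ≥ n` names no variable and
leaves the answer qubit unchanged. -/
def oracleBit {n : ℕ} (X : Fin n → Bool) (i : ℕ) : Bool :=
  if h : i < n then X ⟨i, h⟩ else false

/-- The action `(i, b, z) ↦ (i, b ⊕ x_i, z)` of a query on the basis labels. -/
def queryLabel {n : ℕ} (X : Fin n → Bool) {a w : ℕ} (s : Label a w) : Label a w :=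
  (s.1, xor s.2.1 (oracleBit X s.1), s.2.2)

/-- The matrix of the query `Q_X : |i⟩|b⟩|z⟩ ↦ |i⟩|b ⊕ x_i⟩|z⟩`. -/
def queryMatrix {n : ℕ} (X : Fin n → Bool) (a w : ℕ) : Matrix (Label a w) (Label a w) ℂ :=
  Matrix.of fun s t => if s = queryLabel X t then 1 else 0

/-- A quantum algorithm with `T` queries to an oracle for `n` Boolean variables. Nothing in it
depends on the input. -/
structure QuantumAlgorithm (n T : ℕ) where
  /-- number of address qubits -/
  a : ℕ
  /-- number of work qubits -/
  w : ℕ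
  /-- the initial state -/
  init : Label a w → ℂ
  /-- the initial state is a unit vector -/
  init_unit : ∑ s, ‖init s‖ ^ 2 = 1
  /-- the unitary transformations `U_0, …, U_T` -/
  U : Fin (T + 1) → Matrix.unitaryGroup (Label a w) ℂ
  /-- number of outcomes of the measurement -/
  M : ℕ
  /-- the measurement operators of the final measurement -/
  meas : Fin M → Matrix (Label a w) (Label a w) ℂ
  /-- completeness of the measurement -/
  meas_complete : ∑ j, (meas j)ᴴ * meas j = 1
  /-- the approximation of the mean that is returned on outcome `j` -/
  estimate : Fin M → ℝ

namespace QuantumAlgorithm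

variable {n T : ℕ}

/-- The state `U_t Q_X U_{t-1} Q_X ⋯ U_1 Q_X U_0 |ψ_0⟩`, for `t ≤ T`. -/
def stateAfter (A : QuantumAlgorithm n T) (X : Fin n → Bool) :
    (t : ℕ) → t < T + 1 → Label A.a A.w → ℂ
  | 0, h => (A.U ⟨0, h⟩).1 *ᵥ A.init
  | t + 1, h =>
      (A.U ⟨t + 1, h⟩).1 *ᵥ
        (queryMatrix X A.a A.w *ᵥ A.stateAfter X t (Nat.lt_of_succ_lt h))

/-- The final state, after `T` queries. -/
def finalState (A : QuantumAlgorithm n T) (X : Fin n → Bool) : Label A.a A.w → ℂ :=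
  A.stateAfter X T (Nat.lt_succ_self T)

/-- The probability `p_X(j) = ‖M_j ψ‖²` of outcome `j` on input `X`. -/
noncomputable def prob (A : QuantumAlgorithm n T) (X : Fin n → Bool) (j : Fin A.M) : ℝ :=
  ∑ s, ‖(A.meas j *ᵥ A.finalState X) s‖ ^ 2

/-- The probabilistic error `e(X, T, p)` on input `X`: the infimum of all `γ` such that the
returned value is within `γ` of the mean with probability at least `p`. -/
noncomputable def probError (A : QuantumAlgorithm n T) (X : Fin n → Bool) (p : ℝ) : ℝ :=
  sInf {γ : ℝ | p ≤ ∑ j with |mean X - A.estimate j| ≤ γ, A.prob X j}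

/-- The average probabilistic error with respect to a probability `μ` on the inputs. -/
noncomputable def avgProbError (A : QuantumAlgorithm n T) (p : ℝ) (μ : PMF (Fin n → Bool)) : ℝ :=
  ∑ X, A.probError X p * (μ X).toReal

end QuantumAlgorithm

/-- The uniform probability `μ₁` on `{0,1}^n`. -/
noncomputable def mu1 (n : ℕ) : PMF (Fin n → Bool) :=
  PMF.uniformOfFintype (Fin n → Bool)

theorem mu1_apply (n : ℕ) (X : Fin n → Bool) : (mu1 n X).toReal = ((2 : ℝ) ^ n)⁻¹ := by
  simp [mu1, PMF.uniformOfFintype_apply]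

theorem queryLabel_queryLabel {n : ℕ} (X : Fin n → Bool) {a w : ℕ} (s : Label a w) :
    queryLabel X (queryLabel X s) = s := by
  simp [queryLabel]

theorem queryMatrix_mulVec {n : ℕ} (X : Fin n → Bool) {a w : ℕ} (ψ : Label a w → ℂ)
    (s : Label a w) : (queryMatrix X a w *ᵥ ψ) s = ψ (queryLabel X s) := by
  have h : ∀ t : Label a w, s = queryLabel X t ↔ queryLabel X s = t := fun t =>
    ⟨fun e => by rw [e, queryLabel_queryLabel], fun e => by rw [← e, queryLabel_queryLabel]⟩
  simp [queryMatrix, Matrix.mulVec, dotProduct, h]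

end BoolMean

/-! Draw a random chain of inputs `level 3 ω` ≤ `level 2 ω` ≤ `level 1 ω` with independent
coordinates, where neighbours differ in each coordinate with probability `ε / 2`, and take `ε = n ^
(-1/2)`. The middle input is uniform. The outer two have bits of bias `ε`, so their laws have
bounded second moment relative to the uniform one, and an event of small uniform probability stays
unlikely for all three (`sq_sum_level_mem_le`). Neighbouring means typically differ by order `ε`. If
the average error is a small multiple of `ε`, the algorithm therefore usually succeeds on three
inputs with well separated means, which forces the final states a constant distance apart
(`finalDistSq_add_ge`).

Conversely, the state on one member of the chain cannot tell a coordinate where it differs from its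
neighbour from one where the two agree. A query thus meets a difference with probability only
`O(ε)`, and each query adds `O(ε)` to the expected squared distance
(`sum_normSq_stateAfter_sub_le`). Hence `T * ε` is bounded below. -/

namespace BoolMean

open Finset

/-! ### Norms of amplitude vectors. -/

section Norms

variable {ι : Type*} [Fintype ι]

/-- The squared Euclidean norm of a vector of amplitudes. -/
noncomputable def normSq (v : ι → ℂ) : ℝ := ∑ s, ‖v s‖ ^ 2

theorem normSq_nonneg (v : ι → ℂ) : 0 ≤ normSq v :=
  Finset.sum_nonneg fun _ _ => by positivity

theorem ofReal_normSq (v : ι → ℂ) : (normSq v : ℂ) = star v ⬝ᵥ v := by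
  simp only [normSq, dotProduct, Complex.ofReal_sum, Pi.star_apply]
  refine Finset.sum_congr rfl fun s _ => ?_
  rw [Complex.ofReal_pow, ← Complex.conj_mul']
  rfl

theorem sum_normSq_mulVec [DecidableEq ι] {κ : Type*} [Fintype κ] (K : κ → Matrix ι ι ℂ)
    (hK : ∑ j, (K j)ᴴ * K j = 1) (v : ι → ℂ) : ∑ j, normSq (K j *ᵥ v) = normSq v := by
  have h : ∀ j, star (K j *ᵥ v) ⬝ᵥ (K j *ᵥ v) = star v ⬝ᵥ (((K j)ᴴ * K j) *ᵥ v) := fun j => by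
    rw [star_mulVec, ← dotProduct_mulVec, mulVec_mulVec]
  have : ((∑ j, normSq (K j *ᵥ v) : ℝ) : ℂ) = (normSq v : ℂ) := by
    rw [Complex.ofReal_sum]
    simp only [ofReal_normSq, h]
    rw [← dotProduct_sum, ← Matrix.sum_mulVec, hK, one_mulVec]
  exact_mod_cast this

theorem normSq_unitary_mulVec [DecidableEq ι] (U : Matrix.unitaryGroup ι ℂ) (v : ι → ℂ) :
    normSq (U.1 *ᵥ v) = normSq v := by
  have h := sum_normSq_mulVec (κ := Unit) (fun _ => U.1)
    (by simpa [Matrix.star_eq_conjTranspose] using Matrix.mem_unitaryGroup_iff'.1 U.2) v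
  simpa using h

theorem norm_sub_sq_le {E : Type*} [SeminormedAddCommGroup E] (z w : E) :
    ‖z - w‖ ^ 2 ≤ 2 * ‖z‖ ^ 2 + 2 * ‖w‖ ^ 2 := by
  have := norm_sub_le z w
  nlinarith [sq_nonneg (‖z‖ - ‖w‖), norm_nonneg (z - w)]

/-- Young's inequality, weighted so that the factor on `‖w‖ ^ 2` stays below 2: `finalDistSq_add_ge`
multiplies it by a probability of at most 1/2 and needs a result below 1. -/
theorem norm_sq_le_add {E : Type*} [SeminormedAddCommGroup E] (z w : E) :
    ‖z‖ ^ 2 ≤ 5 / 4 * ‖w‖ ^ 2 + 5 * ‖z - w‖ ^ 2 := by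
  have : ‖z‖ ≤ ‖w‖ + ‖z - w‖ := norm_le_norm_add_norm_sub' z w
  nlinarith [sq_nonneg (‖w‖ - 4 * ‖z - w‖), norm_nonneg z]

end Norms

/-! ### Effect of a single query on distances. -/

section Query

variable {n a w : ℕ}

theorem sum_comp_queryLabel (X : Fin n → Bool) (g : Label a w → ℝ) :
    ∑ s, g (queryLabel X s) = ∑ s, g s :=
  Equiv.sum_comp (Function.Involutive.toPerm (queryLabel X) (queryLabel_queryLabel X)) g

theorem normSq_queryMatrix_mulVec (X : Fin n → Bool) (v : Label a w → ℂ) :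
    normSq (queryMatrix X a w *ᵥ v) = normSq v := by
  simp only [normSq, queryMatrix_mulVec]
  exact sum_comp_queryLabel X fun s => ‖v s‖ ^ 2

/-- A query moves two states apart only on the addresses at which the inputs differ. -/
theorem normSq_query_sub_le (X Y : Fin n → Bool) (u v : Label a w → ℂ) :
    normSq (queryMatrix X a w *ᵥ u - queryMatrix Y a w *ᵥ v) ≤
      normSq (u - v) + 2 * ∑ s : Label a w,
        (if oracleBit X s.1 ≠ oracleBit Y s.1 then ‖u s‖ ^ 2 + ‖v s‖ ^ 2 else 0) := by
  -- Each term is evaluated at the label permuted by its own query, so that summing over `s` removes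
  -- both permutations.
  have key : ∀ s : Label a w,
      ‖u (queryLabel X s) - v (queryLabel Y s)‖ ^ 2 ≤
        ‖u (queryLabel X s) - v (queryLabel X s)‖ ^ 2 +
        2 * ((if oracleBit X (queryLabel X s).1 ≠ oracleBit Y (queryLabel X s).1 then
            ‖u (queryLabel X s)‖ ^ 2 else 0) +
          (if oracleBit X (queryLabel Y s).1 ≠ oracleBit Y (queryLabel Y s).1 then
            ‖v (queryLabel Y s)‖ ^ 2 else 0)) := by
    intro s
    by_cases h : oracleBit X s.1 = oracleBit Y s.1
    · have e : queryLabel Y s = queryLabel X s := by simp [queryLabel, h]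
      simp [e, show (queryLabel X s).1 = s.1 from rfl, h]
    · rw [if_pos (by exact h), if_pos (by exact h)]
      have := norm_sub_sq_le (u (queryLabel X s)) (v (queryLabel Y s))
      nlinarith [sq_nonneg ‖u (queryLabel X s) - v (queryLabel X s)‖]
  calc _ = ∑ s : Label a w, ‖u (queryLabel X s) - v (queryLabel Y s)‖ ^ 2 := by
        simp only [normSq, Pi.sub_apply, queryMatrix_mulVec]
    _ ≤ _ := Finset.sum_le_sum fun s _ => key s
    _ = _ := by
        rw [Finset.sum_add_distrib, ← Finset.mul_sum, Finset.sum_add_distrib,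
          sum_comp_queryLabel X fun s => ‖u s - v s‖ ^ 2,
          sum_comp_queryLabel X fun s =>
            if oracleBit X s.1 ≠ oracleBit Y s.1 then ‖u s‖ ^ 2 else 0,
          sum_comp_queryLabel Y fun s =>
            if oracleBit X s.1 ≠ oracleBit Y s.1 then ‖v s‖ ^ 2 else 0,
          ← Finset.sum_add_distrib]
        congr 2
        refine Finset.sum_congr rfl fun s _ => ?_
        split_ifs <;> simp

end Query

/-! ### Success on separated inputs forces distant final states. -/

namespace QuantumAlgorithm

variable {n T : ℕ} (A : QuantumAlgorithm n T)

theorem normSq_stateAfter (X : Fin n → Bool) (t : ℕ) (h : t < T + 1) :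
    normSq (A.stateAfter X t h) = 1 := by
  induction t with
  | zero => rw [stateAfter, normSq_unitary_mulVec]; exact A.init_unit
  | succ t ih => rw [stateAfter, normSq_unitary_mulVec, normSq_queryMatrix_mulVec, ih]

theorem prob_nonneg (X : Fin n → Bool) (j : Fin A.M) : 0 ≤ A.prob X j :=
  normSq_nonneg (A.meas j *ᵥ A.finalState X)

theorem sum_prob (X : Fin n → Bool) : ∑ j, A.prob X j = 1 :=
  (sum_normSq_mulVec A.meas A.meas_complete (A.finalState X)).trans
    (A.normSq_stateAfter X T _)

/-- The squared distance of the final states on two inputs. -/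
noncomputable def finalDistSq (X Y : Fin n → Bool) : ℝ :=
  normSq (A.finalState X - A.finalState Y)

theorem sum_prob_le (X Y : Fin n → Bool) (J : Finset (Fin A.M)) :
    ∑ j ∈ J, A.prob X j ≤ 5 / 4 * ∑ j ∈ J, A.prob Y j + 5 * A.finalDistSq X Y := by
  have h1 : ∀ j, A.prob X j ≤
      5 / 4 * A.prob Y j + 5 * normSq (A.meas j *ᵥ (A.finalState X - A.finalState Y)) := by
    intro j
    simp only [prob, normSq, Finset.mul_sum, ← Finset.sum_add_distrib, mulVec_sub, Pi.sub_apply]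
    exact Finset.sum_le_sum fun s _ => norm_sq_le_add _ _
  calc _ ≤ ∑ j ∈ J, (5 / 4 * A.prob Y j +
          5 * normSq (A.meas j *ᵥ (A.finalState X - A.finalState Y))) :=
        Finset.sum_le_sum fun j _ => h1 j
    _ = 5 / 4 * ∑ j ∈ J, A.prob Y j +
          5 * ∑ j ∈ J, normSq (A.meas j *ᵥ (A.finalState X - A.finalState Y)) := by
        rw [Finset.sum_add_distrib, ← Finset.mul_sum, ← Finset.mul_sum]
    _ ≤ _ := by
        have : ∑ j ∈ J, normSq (A.meas j *ᵥ (A.finalState X - A.finalState Y)) ≤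
            A.finalDistSq X Y := by
          rw [finalDistSq, ← sum_normSq_mulVec A.meas A.meas_complete]
          exact Finset.sum_le_sum_of_subset_of_nonneg (Finset.subset_univ J)
            fun _ _ _ => normSq_nonneg _
        linarith

/-- The probability that the returned value is within `γ` of the mean. -/
noncomputable def successProb (X : Fin n → Bool) (γ : ℝ) : ℝ :=
  ∑ j with |mean X - A.estimate j| ≤ γ, A.prob X j

theorem successProb_mono (X : Fin n → Bool) : Monotone (A.successProb X) := by
  intro γ γ' h
  refine Finset.sum_le_sum_of_subset_of_nonneg ?_ fun j _ _ => A.prob_nonneg X j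
  intro j
  simp only [Finset.mem_filter, Finset.mem_univ, true_and]
  exact fun hj => hj.trans h

theorem nonneg_of_le_successProb {p : ℝ} (hp : 0 < p) {X : Fin n → Bool} {γ : ℝ}
    (h : p ≤ A.successProb X γ) : 0 ≤ γ := by
  by_contra! hγ
  have : A.successProb X γ = 0 := by
    refine Finset.sum_eq_zero fun j hj => ?_
    have := (abs_nonneg _).trans (Finset.mem_filter.1 hj).2
    linarith
  linarith

theorem probError_nonneg {p : ℝ} (hp : 0 < p) (X : Fin n → Bool) : 0 ≤ A.probError X p :=
  Real.sInf_nonneg fun _ hγ => A.nonneg_of_le_successProb hp hγ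

/-- Makes the set defining `probError` nonempty, so that its `sInf` is approached by members of the
set. -/
theorem exists_le_successProb {p : ℝ} (hp : p ≤ 1) (X : Fin n → Bool) :
    ∃ γ, p ≤ A.successProb X γ := by
  refine ⟨∑ j, |mean X - A.estimate j|, hp.trans ?_⟩
  rw [← A.sum_prob X, successProb, Finset.filter_true_of_mem]
  exact fun j _ => Finset.single_le_sum (f := fun j => |mean X - A.estimate j|)
    (fun _ _ => abs_nonneg _) (Finset.mem_univ j)

theorem le_successProb_of_probError_lt {p : ℝ} (hp1 : p ≤ 1) {X : Fin n → Bool}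
    {γ : ℝ} (h : A.probError X p < γ) : p ≤ A.successProb X γ := by
  obtain ⟨γ', h1, h2⟩ := exists_lt_of_csInf_lt (A.exists_le_successProb hp1 X) h
  exact le_trans h1 (A.successProb_mono X h2.le)

/-- If the algorithm succeeds with probability more than `1/2` on three inputs with well separated
means, then the final states cannot all be close together. -/
theorem finalDistSq_add_ge {X Y Z : Fin n → Bool} {γ : ℝ}
    (hX : 1 / 2 < A.successProb X γ) (hY : 1 / 2 < A.successProb Y γ)
    (hZ : 1 / 2 < A.successProb Z γ) (hXY : mean X + 2 * γ < mean Y)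
    (hYZ : mean Y + 2 * γ < mean Z) :
    3 / 40 ≤ A.finalDistSq X Y + A.finalDistSq Z Y := by
  have hγ : 0 ≤ γ := A.nonneg_of_le_successProb one_half_pos hX.le
  have h1 := A.sum_prob_le X Y (univ.filter fun j => |mean X - A.estimate j| ≤ γ)
  have h2 := A.sum_prob_le Z Y (univ.filter fun j => |mean Z - A.estimate j| ≤ γ)
  -- The three acceptance windows are disjoint. Two inputs would give no constant gap, as `p` may be
  -- arbitrarily close to 1/2; with three, the outer windows share less than 1/2 under `Y`, so `1 <
  -- 5/4 * 1/2 + 5 * (sum of distances)`.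
  have h3 : ∑ j with |mean X - A.estimate j| ≤ γ, A.prob Y j +
      ∑ j with |mean Z - A.estimate j| ≤ γ, A.prob Y j + A.successProb Y γ ≤ 1 := by
    rw [← A.sum_prob Y, successProb]
    simp only [Finset.sum_filter, ← Finset.sum_add_distrib]
    refine Finset.sum_le_sum fun j _ => ?_
    have hj := A.prob_nonneg Y j
    simp only [abs_le]
    split_ifs <;> linarith
  simp only [successProb] at hX hZ h3 hY
  linarith

end QuantumAlgorithm

/-! ### The random chain of inputs. -/

section Chain

/-- The law of one coordinate of a random chain `X ≤ Y ≤ Z` of inputs: the state `s` stands for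
the coordinates `(s ≥ 3, s ≥ 2, s ≥ 1)`. -/
noncomputable def coordWeight (ε : ℝ) : Fin 4 → ℝ := ![(1 - ε) / 2, ε / 2, ε / 2, (1 - ε) / 2]

variable {n : ℕ}

/-- The law of the random chain, with independent coordinates. -/
noncomputable def chainWeight (ε : ℝ) (ω : Fin n → Fin 4) : ℝ := ∏ i, coordWeight ε (ω i)

/-- The member of the chain with threshold `k`. -/
def level (k : Fin 4) (ω : Fin n → Fin 4) : Fin n → Bool := fun i => decide (k ≤ ω i)

variable {ε : ℝ}

theorem coordWeight_nonneg (h0 : 0 ≤ ε) (h1 : ε ≤ 1) (s : Fin 4) : 0 ≤ coordWeight ε s := by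
  fin_cases s <;> simp [coordWeight] <;> linarith

theorem chainWeight_nonneg (h0 : 0 ≤ ε) (h1 : ε ≤ 1) (ω : Fin n → Fin 4) :
    0 ≤ chainWeight ε ω :=
  Finset.prod_nonneg fun _ _ => coordWeight_nonneg h0 h1 _

theorem sum_chainWeight_mul_prod (f : Fin 4 → ℝ) :
    ∑ ω : Fin n → Fin 4, chainWeight ε ω * ∏ i, f (ω i) = (∑ s, coordWeight ε s * f s) ^ n := by
  simp only [chainWeight, ← Finset.prod_mul_distrib]
  exact (Fintype.sum_pow (fun s => coordWeight ε s * f s) n).symm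

theorem sum_chainWeight : ∑ ω : Fin n → Fin 4, chainWeight ε ω = 1 := by
  have h := sum_chainWeight_mul_prod (n := n) (ε := ε) fun _ => 1
  have h2 : ∑ s, coordWeight ε s = 1 := by
    simp [coordWeight, Fin.sum_univ_four]; ring
  simpa [h2] using h

theorem chainWeight_update (h1 : ε < 1) {a b : Fin 4} (ha : a = 1 ∨ a = 2) (hb : b = 0 ∨ b = 3)
    (ω : Fin n → Fin 4) (i : Fin n) (hi : ω i = a) :
    chainWeight ε ω = ε / (1 - ε) * chainWeight ε (Function.update ω i b) := by
  have hε : 1 - ε ≠ 0 := by linarith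
  have hab : coordWeight ε a = ε / (1 - ε) * coordWeight ε b := by
    rcases ha with rfl | rfl <;> rcases hb with rfl | rfl <;> simp [coordWeight] <;> field_simp
  unfold chainWeight
  rw [← Finset.mul_prod_erase _ _ (Finset.mem_univ i),
    ← Finset.mul_prod_erase _ (fun x => coordWeight ε (Function.update ω i b x))
      (Finset.mem_univ i), hi, hab, Function.update_self, mul_assoc]
  congr 2
  refine Finset.prod_congr rfl fun x hx => ?_
  rw [Function.update_of_ne (Finset.ne_of_mem_erase hx)]

/-- The probability that coordinate `i` is in a rare state, given a variable that does not
distinguish it from a frequent state, is at most `ε / (1 - ε)`. -/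
theorem sum_rare_le (h0 : 0 ≤ ε) (h1 : ε < 1) {a b : Fin 4} (ha : a = 1 ∨ a = 2)
    (hb : b = 0 ∨ b = 3) (i : Fin n) (g : (Fin n → Fin 4) → ℝ) (hg : ∀ ω, 0 ≤ g ω)
    (hgu : ∀ ω, ω i = a → g (Function.update ω i b) = g ω) :
    ∑ ω, chainWeight ε ω * (if ω i = a then g ω else 0) ≤
      ε / (1 - ε) * ∑ ω, chainWeight ε ω * g ω := by
  have hr : 0 ≤ ε / (1 - ε) := div_nonneg h0 (by linarith)
  have e : ∑ ω with ω i = a, chainWeight ε ω * g ω =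
      ∑ ω with ω i = b, ε / (1 - ε) * (chainWeight ε ω * g ω) := by
    refine Finset.sum_nbij' (fun ω => Function.update ω i b) (fun ω => Function.update ω i a)
      ?_ ?_ ?_ ?_ ?_
    · simp
    · simp
    · intro ω hω
      simp [← (Finset.mem_filter.1 hω).2]
    · intro ω hω
      simp [← (Finset.mem_filter.1 hω).2]
    · intro ω hω
      have hi := (Finset.mem_filter.1 hω).2
      rw [hgu ω hi, chainWeight_update h1 ha hb ω i hi]
      ring
  calc _ = ∑ ω with ω i = a, chainWeight ε ω * g ω := by
        rw [Finset.sum_filter]; simp only [mul_ite, mul_zero]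
    _ = ∑ ω with ω i = b, ε / (1 - ε) * (chainWeight ε ω * g ω) := e
    _ ≤ ∑ ω, ε / (1 - ε) * (chainWeight ε ω * g ω) :=
        Finset.sum_le_sum_of_subset_of_nonneg (Finset.subset_univ _) fun ω _ _ =>
          mul_nonneg hr (mul_nonneg (chainWeight_nonneg h0 h1.le ω) (hg ω))
    _ = _ := by rw [Finset.mul_sum]

/-- The law of one coordinate of `level k`. -/
noncomputable def bitWeight (ε : ℝ) (k : Fin 4) (b : Bool) : ℝ :=
  ∑ s with decide (k ≤ s) = b, coordWeight ε s

theorem sum_level_eq (k : Fin 4) (x : Fin n → Bool) :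
    ∑ ω with level k ω = x, chainWeight ε ω = ∏ i, bitWeight ε k (x i) := by
  unfold bitWeight chainWeight
  rw [Finset.prod_univ_sum]
  refine Finset.sum_congr ?_ fun _ _ => rfl
  ext ω
  simp [level, funext_iff, Fintype.mem_piFinset]

/-- Cauchy–Schwarz on `B`, with the second moment of the product law factoring over coordinates.
`level 0` is excluded because it is constantly true. -/
theorem sq_sum_level_mem_le (k : Fin 4) (hk : k ≠ 0) (B : Finset (Fin n → Bool)) :
    (∑ ω, chainWeight ε ω * (if level k ω ∈ B then 1 else 0)) ^ 2 ≤
      #B * ((1 + ε ^ 2) / 2) ^ n := by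
  have e : ∑ ω, chainWeight ε ω * (if level k ω ∈ B then 1 else 0) =
      ∑ x ∈ B, ∏ i, bitWeight ε k (x i) := by
    simp only [mul_ite, mul_one, mul_zero, ← sum_level_eq, ← Finset.sum_filter]
    rw [← Finset.sum_fiberwise_of_maps_to (s := univ.filter fun ω => level k ω ∈ B) (t := B)
      (g := level k) (by simp)]
    refine Finset.sum_congr rfl fun x hx => Finset.sum_congr ?_ fun _ _ => rfl
    ext ω
    simp only [Finset.mem_filter, Finset.mem_univ, true_and]
    exact ⟨fun h => h.2, fun h => ⟨h ▸ hx, h⟩⟩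
  have hq : ∑ b, bitWeight ε k b ^ 2 ≤ (1 + ε ^ 2) / 2 := by
    have := sq_nonneg ε
    fin_cases k
    · exact absurd rfl hk
    all_goals
      simp [bitWeight, coordWeight, Finset.sum_filter, Fin.sum_univ_four]
      nlinarith
  rw [e]
  refine sq_sum_le_card_mul_sum_sq.trans (mul_le_mul_of_nonneg_left ?_ (Nat.cast_nonneg _))
  calc ∑ x ∈ B, (∏ i, bitWeight ε k (x i)) ^ 2
      ≤ ∑ x : Fin n → Bool, (∏ i, bitWeight ε k (x i)) ^ 2 :=
        Finset.sum_le_sum_of_subset_of_nonneg (Finset.subset_univ _) fun _ _ _ => sq_nonneg _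
    _ = (∑ b, bitWeight ε k b ^ 2) ^ n := by
        rw [Fintype.sum_pow (fun b => bitWeight ε k b ^ 2) n]
        exact Finset.sum_congr rfl fun x _ => (Finset.prod_pow _ _ _).symm
    _ ≤ _ := pow_le_pow_left₀ (Finset.sum_nonneg fun _ _ => sq_nonneg _) hq n

/-- A lower tail bound for the number of coordinates in a rare state. -/
theorem sum_card_rare_le (h0 : 0 ≤ ε) (h1 : ε ≤ 1) {a : Fin 4} (ha : a = 1 ∨ a = 2) (L : ℝ) :
    ∑ ω : Fin n → Fin 4, chainWeight ε ω * (if (#{i | ω i = a} : ℝ) ≤ L then 1 else 0) ≤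
      Real.exp (L - n * ε / 4) := by
  have hw : coordWeight ε a = ε / 2 := by rcases ha with rfl | rfl <;> simp [coordWeight]
  -- Chernoff's method at parameter -1: the one-coordinate moment is `1 - ε / 2 * (1 - exp (-1)) ≤ 1
  -- - ε / 4`.
  have hs : ∑ s, coordWeight ε s * Real.exp (if s = a then -1 else 0) ≤ Real.exp (-(ε / 4)) := by
    have e : ∀ s, coordWeight ε s * Real.exp (if s = a then -1 else 0) =
        coordWeight ε s - if s = a then coordWeight ε s * (1 - Real.exp (-1)) else 0 := by
      intro s
      split_ifs
      · ring
      · rw [Real.exp_zero]; ring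
    have hsum : ∑ s, coordWeight ε s = 1 := by
      simp [coordWeight, Fin.sum_univ_four]; ring
    simp only [e, Finset.sum_sub_distrib, Finset.sum_ite_eq', Finset.mem_univ, if_true, hw, hsum]
    have h2 : Real.exp (-1) ≤ 1 / 2 := by
      rw [Real.exp_neg, ← one_div]
      exact one_div_le_one_div_of_le (by norm_num) (by linarith [Real.add_one_le_exp (1 : ℝ)])
    nlinarith [Real.add_one_le_exp (-(ε / 4))]
  have hprod : ∀ ω : Fin n → Fin 4, ∏ i, Real.exp (if ω i = a then -1 else 0) =
      Real.exp (-(#{i | ω i = a} : ℝ)) := by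
    intro ω
    rw [← Real.exp_sum]
    simp [Finset.sum_ite]
  calc _ ≤ ∑ ω : Fin n → Fin 4, Real.exp L *
          (chainWeight ε ω * ∏ i, Real.exp (if ω i = a then -1 else 0)) := by
        refine Finset.sum_le_sum fun ω _ => ?_
        rw [hprod, mul_left_comm, ← Real.exp_add]
        refine mul_le_mul_of_nonneg_left ?_ (chainWeight_nonneg h0 h1 ω)
        split_ifs with h
        · exact Real.one_le_exp (by linarith)
        · positivity
    _ = Real.exp L * (∑ s, coordWeight ε s * Real.exp (if s = a then -1 else 0)) ^ n := by
        rw [← Finset.mul_sum, sum_chainWeight_mul_prod fun s => Real.exp (if s = a then -1 else 0)]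
    _ ≤ Real.exp L * Real.exp (-(ε / 4)) ^ n := by
        refine mul_le_mul_of_nonneg_left (pow_le_pow_left₀ ?_ hs n) (Real.exp_pos L).le
        exact Finset.sum_nonneg fun s _ =>
          mul_nonneg (coordWeight_nonneg h0 h1 s) (Real.exp_pos _).le
    _ = _ := by
        rw [← Real.exp_nat_mul, ← Real.exp_add]
        congr 1; ring

theorem mean_level_sub {k l a : Fin 4} (h : ∀ s : Fin 4, l ≤ s ↔ k ≤ s ∨ s = a)
    (hka : ¬ k ≤ a) (ω : Fin n → Fin 4) :
    mean (level l ω) = mean (level k ω) + (#{i | ω i = a} : ℝ) / n := by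
  unfold mean level
  rw [← add_div, Finset.card_filter]
  push_cast
  rw [← Finset.sum_add_distrib]
  congr 1
  refine Finset.sum_congr rfl fun i _ => ?_
  by_cases h1 : ω i = a
  · simp [h, h1, hka]
  · simp [h, h1]

end Chain

/-! ### Hybrid argument along the chain, and the lower bound. -/

namespace QuantumAlgorithm

variable {n T : ℕ} (A : QuantumAlgorithm n T)

/-- On average over adjacent members of the chain, each query adds at most `4ε / (1 - ε)` to the
squared distance of the states. -/
theorem sum_normSq_stateAfter_sub_le {ε : ℝ} (h0 : 0 ≤ ε) (h1 : ε < 1) {k l a b b' : Fin 4}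
    (ha : a = 1 ∨ a = 2) (hb : b = 0 ∨ b = 3) (hb' : b' = 0 ∨ b' = 3)
    (hkl : ∀ s : Fin 4, ¬(k ≤ s ↔ l ≤ s) → s = a) (hkb : k ≤ b ↔ k ≤ a) (hlb : l ≤ b' ↔ l ≤ a)
    (t : ℕ) (ht : t < T + 1) :
    ∑ ω, chainWeight ε ω *
        normSq (A.stateAfter (level k ω) t ht - A.stateAfter (level l ω) t ht) ≤
      t * (4 * (ε / (1 - ε))) := by
  -- Moving a coordinate from the rare state `a` to a frequent state on the same side of the
  -- threshold leaves the input, hence the algorithm's state, unchanged.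
  have upd : ∀ (k b : Fin 4), (k ≤ b ↔ k ≤ a) → ∀ (ω : Fin n → Fin 4) (i : Fin n), ω i = a →
      level k (Function.update ω i b) = level k ω := by
    intro k b hk ω i hi
    funext j
    by_cases hj : j = i
    · subst hj; simp [level, hi, hk]
    · simp [level, Function.update_of_ne hj]
  have hr : 0 ≤ ε / (1 - ε) := div_nonneg h0 (by linarith)
  induction t with
  | zero => simp [stateAfter, normSq]
  | succ t ih =>
    have ht' : t < T + 1 := Nat.lt_of_succ_lt ht
    have rare : ∀ (m b : Fin 4), (b = 0 ∨ b = 3) → (m ≤ b ↔ m ≤ a) → ∀ s : Label A.a A.w,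
        ∑ ω, chainWeight ε ω * (if oracleBit (level k ω) s.1 ≠ oracleBit (level l ω) s.1 then
            ‖A.stateAfter (level m ω) t ht' s‖ ^ 2 else 0) ≤
          ε / (1 - ε) * ∑ ω, chainWeight ε ω * ‖A.stateAfter (level m ω) t ht' s‖ ^ 2 := by
      intro m b hb hm s
      by_cases hs : (s.1 : ℕ) < n
      · refine le_trans (Finset.sum_le_sum fun ω _ => ?_)
          (sum_rare_le h0 h1 ha hb ⟨s.1, hs⟩
            (fun ω => ‖A.stateAfter (level m ω) t ht' s‖ ^ 2) (fun _ => sq_nonneg _)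
            (fun ω hω => by rw [upd m b hm ω _ hω]))
        refine mul_le_mul_of_nonneg_left ?_ (chainWeight_nonneg h0 h1.le ω)
        by_cases hω : ω ⟨s.1, hs⟩ = a
        · rw [if_pos hω]
          split_ifs
          · exact le_rfl
          · positivity
        · rw [if_neg hω, if_neg]
          simp only [oracleBit, hs, dif_pos, level, not_not, decide_eq_decide]
          by_contra hne
          exact hω (hkl _ hne)
      · simp only [oracleBit, hs, dif_neg, not_false_eq_true, ne_eq, not_true_eq_false, if_false,
          mul_zero, Finset.sum_const_zero]
        exact mul_nonneg hr (Finset.sum_nonneg fun ω _ =>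
          mul_nonneg (chainWeight_nonneg h0 h1.le ω) (sq_nonneg _))
    have total : ∀ (m b : Fin 4), (b = 0 ∨ b = 3) → (m ≤ b ↔ m ≤ a) →
        ∑ ω, chainWeight ε ω * ∑ s : Label A.a A.w,
          (if oracleBit (level k ω) s.1 ≠ oracleBit (level l ω) s.1 then
            ‖A.stateAfter (level m ω) t ht' s‖ ^ 2 else 0) ≤ ε / (1 - ε) := by
      intro m b hb hm
      simp only [Finset.mul_sum]
      rw [Finset.sum_comm]
      calc _ ≤ ∑ s : Label A.a A.w, ε / (1 - ε) * ∑ ω, chainWeight ε ω *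
              ‖A.stateAfter (level m ω) t ht' s‖ ^ 2 :=
            Finset.sum_le_sum fun s _ => rare m b hb hm s
        _ = ε / (1 - ε) * ∑ ω, chainWeight ε ω *
              normSq (A.stateAfter (level m ω) t ht') := by
            rw [← Finset.mul_sum, Finset.sum_comm]
            simp only [normSq, Finset.mul_sum]
        _ = ε / (1 - ε) := by
            simp only [A.normSq_stateAfter, mul_one, sum_chainWeight]
    have step : ∀ ω : Fin n → Fin 4, chainWeight ε ω *
        normSq (A.stateAfter (level k ω) (t + 1) ht - A.stateAfter (level l ω) (t + 1) ht) ≤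
        chainWeight ε ω *
          normSq (A.stateAfter (level k ω) t ht' - A.stateAfter (level l ω) t ht') +
        2 * (chainWeight ε ω * ∑ s : Label A.a A.w,
          (if oracleBit (level k ω) s.1 ≠ oracleBit (level l ω) s.1 then
            ‖A.stateAfter (level k ω) t ht' s‖ ^ 2 else 0)) +
        2 * (chainWeight ε ω * ∑ s : Label A.a A.w,
          (if oracleBit (level k ω) s.1 ≠ oracleBit (level l ω) s.1 then
            ‖A.stateAfter (level l ω) t ht' s‖ ^ 2 else 0)) := by
      intro ω
      rw [stateAfter, stateAfter, ← mulVec_sub, normSq_unitary_mulVec]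
      refine (mul_le_mul_of_nonneg_left (normSq_query_sub_le _ _ _ _)
        (chainWeight_nonneg h0 h1.le ω)).trans (le_of_eq ?_)
      have : ∀ (P : Label A.a A.w → Prop) [DecidablePred P] (f g : Label A.a A.w → ℝ),
          ∑ s, (if P s then f s + g s else 0) =
            ∑ s, (if P s then f s else 0) + ∑ s, (if P s then g s else 0) := by
        intro P _ f g
        rw [← Finset.sum_add_distrib]
        exact Finset.sum_congr rfl fun s _ => by split_ifs <;> simp
      rw [this]
      ring
    refine (Finset.sum_le_sum fun ω _ => step ω).trans ?_
    rw [Finset.sum_add_distrib, Finset.sum_add_distrib, ← Finset.mul_sum, ← Finset.mul_sum]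
    have i1 := ih ht'
    have i2 := total k b hb hkb
    have i3 := total l b' hb' hlb
    push_cast
    linarith

/-- Markov's inequality for the uniform measure. -/
theorem card_probError_gt_le {p c : ℝ} (hp : 0 < p) {δ : ℝ} (hc : 0 < c)
    (h : A.avgProbError p (mu1 n) ≤ δ * c) :
    (#{X | c ≤ A.probError X p} : ℝ) ≤ δ * 2 ^ n := by
  have h2 : (0 : ℝ) < 2 ^ n := by positivity
  have h3 : ∑ X, A.probError X p ≤ δ * c * 2 ^ n := by
    simp only [avgProbError, mu1_apply, ← Finset.sum_mul] at h
    rwa [← div_eq_mul_inv, div_le_iff₀ h2] at h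
  have h4 : (#{X | c ≤ A.probError X p} : ℝ) * c ≤ ∑ X, A.probError X p := by
    rw [← nsmul_eq_mul]
    refine (Finset.card_nsmul_le_sum _ (fun X => A.probError X p) c
      fun X hX => (Finset.mem_filter.1 hX).2).trans ?_
    exact Finset.sum_le_sum_of_subset_of_nonneg (Finset.subset_univ _) fun X _ _ =>
      A.probError_nonneg hp X
  nlinarith

theorem sqrt_le_queries (hn : 10000 ≤ n) {p : ℝ} (hp : 1 / 2 < p) (hp1 : p ≤ 1)
    (h : A.avgProbError p (mu1 n) ≤ 1 / 9600 * (√n)⁻¹) : 1 / 1000 * √n ≤ T := by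
  have hR : 100 ≤ √(n : ℝ) := by
    refine Real.le_sqrt_of_sq_le ?_
    have : (10000 : ℝ) ≤ n := by exact_mod_cast hn
    linarith
  have hn0 : (n : ℝ) = √n * √n := (Real.mul_self_sqrt (Nat.cast_nonneg n)).symm
  set R := √(n : ℝ) with hRdef
  have hR0 : 0 < R := by linarith
  set ε := R⁻¹ with hε
  have hεR : ε * R = 1 := inv_mul_cancel₀ hR0.ne'
  have h0 : 0 < ε := inv_pos.2 hR0
  have h1 : ε ≤ 1 / 100 := by nlinarith
  have h1' : ε < 1 := by linarith
  -- More than `R / 8` differing coordinates separate the means by more than `ε / 8 = 4 * γ`. Since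
  -- `1 / 9600 = 1 / 300 * 1 / 32`, Markov gives the bad set density at most `1 / 300`.
  set γ := ε / 32 with hγ
  set B : Finset (Fin n → Bool) := {X | γ ≤ A.probError X p} with hB
  have hBcard : (#B : ℝ) ≤ 1 / 300 * 2 ^ n :=
    A.card_probError_gt_le (by linarith) (by positivity) (h.trans (by linarith))
  have hbad : ∀ k : Fin 4, k ≠ 0 →
      ∑ ω, chainWeight ε ω * (if level k ω ∈ B then (1 : ℝ) else 0) ≤ 1 / 10 := by
    intro k hk
    refine abs_le_of_sq_le_sq' ((sq_sum_level_mem_le k hk B).trans ?_) (by norm_num) |>.2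
    have e1 : (1 + ε ^ 2) ^ n ≤ 3 := by
      have : (1 + ε ^ 2) ≤ Real.exp (ε ^ 2) := by linarith [Real.add_one_le_exp (ε ^ 2)]
      calc _ ≤ Real.exp (ε ^ 2) ^ n := pow_le_pow_left₀ (by positivity) this n
        _ = Real.exp 1 := by
            rw [← Real.exp_nat_mul, hn0]
            congr 1
            calc R * R * ε ^ 2 = (ε * R) ^ 2 := by ring
              _ = 1 := by rw [hεR]; norm_num
        _ ≤ 3 := by linarith [Real.exp_one_lt_d9]
    calc (#B : ℝ) * ((1 + ε ^ 2) / 2) ^ n ≤ 1 / 300 * 2 ^ n * ((1 + ε ^ 2) / 2) ^ n :=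
          mul_le_mul_of_nonneg_right hBcard (by positivity)
      _ = 1 / 300 * (1 + ε ^ 2) ^ n := by
          rw [mul_assoc, ← mul_pow, mul_div_cancel₀ _ (two_ne_zero)]
      _ ≤ _ := by linarith
  have htail : ∀ a : Fin 4, a = 1 ∨ a = 2 → ∑ ω : Fin n → Fin 4, chainWeight ε ω *
      (if (#{i | ω i = a} : ℝ) ≤ R / 8 then (1 : ℝ) else 0) ≤ 1 / 10 := by
    intro a ha
    refine (sum_card_rare_le h0.le h1'.le ha (R / 8)).trans ?_
    have e1 : R / 8 - n * ε / 4 = -(R / 8) := by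
      have : (n : ℝ) * ε = R := by rw [hn0, mul_assoc, mul_comm R ε, hεR, mul_one]
      rw [this]; ring
    rw [e1, Real.exp_neg, ← one_div]
    exact one_div_le_one_div_of_le (by norm_num) (by linarith [Real.add_one_le_exp (R / 8)])
  have hgood : ∀ ω : Fin n → Fin 4,
      3 / 40 * (1 - (if level 3 ω ∈ B then (1 : ℝ) else 0) - (if level 2 ω ∈ B then 1 else 0) -
        (if level 1 ω ∈ B then 1 else 0) - (if (#{i | ω i = 1} : ℝ) ≤ R / 8 then 1 else 0) -
        (if (#{i | ω i = 2} : ℝ) ≤ R / 8 then 1 else 0)) ≤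
      A.finalDistSq (level 3 ω) (level 2 ω) + A.finalDistSq (level 1 ω) (level 2 ω) := by
    intro ω
    have hpos : 0 ≤ A.finalDistSq (level 3 ω) (level 2 ω) +
        A.finalDistSq (level 1 ω) (level 2 ω) := add_nonneg (normSq_nonneg _) (normSq_nonneg _)
    by_cases g : level 3 ω ∉ B ∧ level 2 ω ∉ B ∧ level 1 ω ∉ B ∧
        R / 8 < (#{i | ω i = 1} : ℝ) ∧ R / 8 < (#{i | ω i = 2} : ℝ)
    · obtain ⟨g3, g2, g1, t1, t2⟩ := g
      rw [if_neg g3, if_neg g2, if_neg g1, if_neg t1.not_ge, if_neg t2.not_ge]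
      have succ : ∀ X, X ∉ B → 1 / 2 < A.successProb X γ := fun X hX =>
        hp.trans_le (A.le_successProb_of_probError_lt hp1 (by simpa [hB] using hX))
      have sep : ∀ x : ℝ, R / 8 < x → 2 * γ < x / n := by
        intro x hx
        rw [lt_div_iff₀ (by rw [hn0]; positivity), hn0]
        calc 2 * γ * (R * R) = (ε * R) * R / 16 := by rw [hγ]; ring
          _ < x := by rw [hεR]; linarith
      have m1 := mean_level_sub (k := 3) (l := 2) (a := 2) (by decide) (by decide) ω
      have m2 := mean_level_sub (k := 2) (l := 1) (a := 1) (by decide) (by decide) ω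
      have := A.finalDistSq_add_ge (succ _ g3) (succ _ g2) (succ _ g1)
        (by rw [m1]; linarith [sep _ t2]) (by rw [m2]; linarith [sep _ t1])
      linarith
    · have hi : ∀ (P : Prop) [Decidable P], (0 : ℝ) ≤ if P then 1 else 0 := fun P _ => by
        split_ifs <;> norm_num
      have : 1 ≤ (if level 3 ω ∈ B then (1 : ℝ) else 0) + (if level 2 ω ∈ B then 1 else 0) +
        (if level 1 ω ∈ B then 1 else 0) + (if (#{i | ω i = 1} : ℝ) ≤ R / 8 then 1 else 0) +
        (if (#{i | ω i = 2} : ℝ) ≤ R / 8 then 1 else 0) := by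
        have i1 := hi (level 3 ω ∈ B)
        have i2 := hi (level 2 ω ∈ B)
        have i3 := hi (level 1 ω ∈ B)
        have i4 := hi ((#{i | ω i = 1} : ℝ) ≤ R / 8)
        have i5 := hi ((#{i | ω i = 2} : ℝ) ≤ R / 8)
        by_contra! hlt
        refine g ⟨fun q => ?_, fun q => ?_, fun q => ?_, not_le.1 fun q => ?_,
          not_le.1 fun q => ?_⟩ <;> rw [if_pos q] at hlt <;> linarith
      linarith
  -- Five exceptional events of probability at most `1 / 10` each leave half of `3 / 40`.
  have hlow : 3 / 80 ≤ ∑ ω, chainWeight ε ω * (A.finalDistSq (level 3 ω) (level 2 ω) +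
      A.finalDistSq (level 1 ω) (level 2 ω)) := by
    have := Finset.sum_le_sum fun (ω : Fin n → Fin 4) (_ : ω ∈ univ) =>
      mul_le_mul_of_nonneg_left (hgood ω) (chainWeight_nonneg h0.le h1'.le ω)
    refine le_trans ?_ this
    simp only [mul_left_comm _ (3 / 40 : ℝ), mul_sub, Finset.sum_sub_distrib, ← Finset.mul_sum,
      ← Finset.sum_mul, mul_one, sum_chainWeight]
    have b3 := hbad 3 (by decide)
    have b2 := hbad 2 (by decide)
    have b1 := hbad 1 (by decide)
    have t1 := htail 1 (by simp)
    have t2 := htail 2 (by simp)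
    linarith
  have hup1 := A.sum_normSq_stateAfter_sub_le h0.le h1' (k := 3) (l := 2) (a := 2) (b := 0)
    (b' := 3) (by simp) (by simp) (by simp) (by decide) (by decide) (by decide) T
    (Nat.lt_succ_self T)
  have hup2 := A.sum_normSq_stateAfter_sub_le h0.le h1' (k := 1) (l := 2) (a := 1) (b := 3)
    (b' := 0) (by simp) (by simp) (by simp) (by decide) (by decide) (by decide) T
    (Nat.lt_succ_self T)
  have hr : ε / (1 - ε) ≤ 2 * ε := by
    rw [div_le_iff₀ (by linarith)]; nlinarith
  simp only [mul_add, Finset.sum_add_distrib] at hlow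
  have hfin : (3 : ℝ) / 80 ≤ T * (16 * ε) := by
    have hT : (T : ℝ) * (4 * (ε / (1 - ε))) ≤ T * (4 * (2 * ε)) :=
      mul_le_mul_of_nonneg_left (by linarith) (Nat.cast_nonneg T)
    simp only [finalDistSq, finalState] at hlow
    linarith
  have := mul_le_mul_of_nonneg_right hfin hR0.le
  have e : (T : ℝ) * (16 * ε) * R = 16 * T := by
    calc _ = 16 * T * (ε * R) := by ring
      _ = _ := by rw [hεR, mul_one]
  rw [e] at this
  linarith

end QuantumAlgorithm

end BoolMean

theorem lemma3p1 :
    ∃ c : ℝ, 0 < c ∧ ∃ C : ℝ, 0 < C ∧ ∃ N : ℕ, ∀ n : ℕ, N ≤ n →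
      ∀ p : ℝ, 1 / 2 < p → p ≤ 1 → ∀ (T : ℕ) (A : BoolMean.QuantumAlgorithm n T),
        A.avgProbError p (BoolMean.mu1 n) ≤ c * (n : ℝ) ^ (-(1 / 2) : ℝ) →
          C * (n : ℝ) ^ (1 / 2 : ℝ) ≤ (T : ℝ) := by
  refine ⟨1 / 9600, by norm_num, 1 / 1000, by norm_num, 10000,
    fun n hn p hp hp1 T A h => ?_⟩
  rw [Real.rpow_neg (Nat.cast_nonneg n), ← Real.sqrt_eq_rpow] at h
  rw [← Real.sqrt_eq_rpow]
  exact A.sqrt_le_queries hn hp hp1 h
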